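/- Let $\mathbb{K}=\mathbb{R}$ or $\mathbb{C}$ and let $1\le p<\infty$. For a bounded sequence $w=(w_n)_{n\ge 1}$ in $\mathbb{K}$, let $B_w$ be the unilateral weighted backward shift on $\ell^p(\mathbb{N})$ (over $\mathbb{K}$), given on the canonical basis by $B_we_1=0$ and $B_we_n=w_ne_{n-1}$ for $n\ge 2$. For $A\subset\mathbb{N}$ let $$\overline{\mathrm{dens}}\,A=\limsup_{N\to\infty}\frac{\mathrm{card}(A\cap[1,N])}{N},\qquad \overline{\mathrm{Bd}}\,A=\limsup_{N\to\infty}\max_{k\ge 1}\frac{\mathrm{card}(A\cap[k+1,k+N])}{N}$$ be its upper density and its upper Banach density. A continuous linear operator $T$ on a Banach space $X$ is upper frequently hypercyclic if there is $x\in X$ such that $\overline{\mathrm{dens}}\{n: T^nx\in U\}>0$ for every non-empty open set $U\subset X$. Continuous linear operators $T_1,T_2$ on $X$ are disjoint upper frequently hypercyclic (respectively, disjoint reiteratively hypercyclic) if there is $x\in X$ such that for every non-empty open set $U\subset X\times X$ the set $\{n: (T_1^nx,T_2^nx)\in U\}$ has positive upper density (respectively, positive upper Banach density). Then there exist bounded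 sequences $v$ and $w$ in $\mathbb{K}$ such that $B_v$ and $B_w$ are upper frequently hypercyclic on $\ell^p(\mathbb{N})$, and $B_v$ and $B_w$ are disjoint reiteratively hypercyclic but not disjoint upper frequently hypercyclic. -/

import Mathlib

open scoped ENNReal

noncomputable section

/-- The upper density `limsup_{N → ∞} card {n ∈ A : 1 ≤ n ≤ N} / N` of a set `A` of natural
numbers. -/
def upperDensity (A : Set ℕ) : ℝ :=
  Filter.limsup (fun N : ℕ => ((A ∩ Set.Icc 1 N).ncard : ℝ) / (N : ℝ)) Filter.atTop

/-- The upper Banach density `limsup_{N → ∞} max_{k ≥ 1} card (A ∩ [k + 1, k + N]) / N` of a set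
`A` of natural numbers. -/
def upperBanachDensity (A : Set ℕ) : ℝ :=
  Filter.limsup
    (fun N : ℕ => ⨆ k : ℕ+, ((A ∩ Set.Icc ((k : ℕ) + 1) ((k : ℕ) + N)).ncard : ℝ) / (N : ℝ))
    Filter.atTop

/-- The family of sets of natural numbers of positive upper density. -/
def posUpperDensity : Set (Set ℕ) := {A | 0 < upperDensity A}

/-- The family of sets of natural numbers of positive upper Banach density. -/
def posUpperBanachDensity : Set (Set ℕ) := {A | 0 < upperBanachDensity A}

section Hypercyclicity

variable {𝕜 X : Type*} [NontriviallyNormedField 𝕜] [NormedAddCommGroup X] [NormedSpace 𝕜 X]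

/-- `x` is an `𝒜`-hypercyclic vector for `T`: for every non-empty open set `U`, the set of return
times `{n : T ^ n x ∈ U}` belongs to the family `𝒜`. -/
def IsHypercyclicVectorFor (𝒜 : Set (Set ℕ)) (T : X →L[𝕜] X) (x : X) : Prop :=
  ∀ U : Set X, IsOpen U → U.Nonempty → {n : ℕ | (T ^ n) x ∈ U} ∈ 𝒜

/-- `T` is `𝒜`-hypercyclic: it has an `𝒜`-hypercyclic vector. -/
def IsHypercyclicFor (𝒜 : Set (Set ℕ)) (T : X →L[𝕜] X) : Prop :=
  ∃ x : X, IsHypercyclicVectorFor 𝒜 T x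

/-- The operators `T 0, …, T (N - 1)` are disjoint `𝒜`-hypercyclic: the direct sum
`(x₀, …, x_{N-1}) ↦ (T 0 x₀, …, T (N - 1) x_{N-1})` on `X ^ N` has an `𝒜`-hypercyclic vector of
the form `(x, …, x)`. -/
def AreDisjointHypercyclicFor (𝒜 : Set (Set ℕ)) {N : ℕ} (T : Fin N → (X →L[𝕜] X)) : Prop :=
  ∃ x : X, IsHypercyclicVectorFor 𝒜 (ContinuousLinearMap.piMap T) (fun _ : Fin N => x)

/-- Upper frequent hypercyclicity. -/
def IsUpperFrequentlyHypercyclic (T : X →L[𝕜] X) : Prop :=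
  IsHypercyclicFor posUpperDensity T

/-- Disjoint upper frequent hypercyclicity. -/
def AreDisjointUpperFrequentlyHypercyclic {N : ℕ} (T : Fin N → (X →L[𝕜] X)) : Prop :=
  AreDisjointHypercyclicFor posUpperDensity T

/-- Disjoint reiterative hypercyclicity. -/
def AreDisjointReiterativelyHypercyclic {N : ℕ} (T : Fin N → (X →L[𝕜] X)) : Prop :=
  AreDisjointHypercyclicFor posUpperBanachDensity T

end Hypercyclicity

section WeightedShift

variable {𝕜 : Type*} [RCLike 𝕜]

/-- A weight sequence, i.e. a bounded sequence of scalars. -/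
def IsWeight (w : ℕ → 𝕜) : Prop := BddAbove (Set.range fun n => ‖w n‖)

theorem weightedShift_memℓp {p : ℝ≥0∞} {w : ℕ → 𝕜} (hw : IsWeight w)
    {x : ℕ → 𝕜} (hx : Memℓp x p) : Memℓp (fun n => w (n + 1) * x (n + 1)) p := by
  obtain ⟨C, hC⟩ := hw
  have hwC : ∀ n, ‖w n‖ ≤ C := fun n => hC ⟨n, rfl⟩
  have hC0 : 0 ≤ C := (norm_nonneg _).trans (hwC 0)
  rcases p.trichotomy with rfl | rfl | hp
  · refine memℓp_zero ?_
    have h := (memℓp_zero_iff.1 hx).preimage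
      (f := fun n : ℕ => n + 1) (add_left_injective 1).injOn
    exact h.subset fun n hn h0 => hn (by simp [h0])
  · refine memℓp_infty ?_
    obtain ⟨D, hD⟩ := memℓp_infty_iff.1 hx
    refine ⟨C * D, ?_⟩
    rintro _ ⟨n, rfl⟩
    have hxn : ‖x (n + 1)‖ ≤ D := hD ⟨n + 1, rfl⟩
    simpa using mul_le_mul (hwC (n + 1)) hxn (norm_nonneg _) hC0
  · refine memℓp_gen ?_
    have hs := ((memℓp_gen_iff hp).1 hx).comp_injective (add_left_injective 1)
    refine Summable.of_nonneg_of_le (fun n => by positivity) (fun n => ?_)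
      (hs.mul_left (C ^ p.toReal))
    rw [norm_mul, Real.mul_rpow (norm_nonneg _) (norm_nonneg _)]
    simp only [Function.comp_apply]
    gcongr
    exact hwC _

theorem weightedShift_norm_le {p : ℝ≥0∞} [Fact (1 ≤ p)] {w : ℕ → 𝕜} {C : ℝ}
    (hwC : ∀ n, ‖w n‖ ≤ C) (x y : lp (fun _ : ℕ => 𝕜) p)
    (hy : ∀ n, y n = w (n + 1) * x (n + 1)) : ‖y‖ ≤ C * ‖x‖ := by
  have hC0 : 0 ≤ C := (norm_nonneg _).trans (hwC 0)
  have hp1 : (1 : ℝ≥0∞) ≤ p := Fact.out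
  rcases p.trichotomy with rfl | rfl | hp
  · simp at hp1
  · refine lp.norm_le_of_forall_le (by positivity) fun n => ?_
    rw [hy, norm_mul]
    exact mul_le_mul (hwC _) (lp.norm_apply_le_norm (by simp) x _) (norm_nonneg _) hC0
  · refine lp.norm_le_of_forall_sum_le hp (by positivity) fun s => ?_
    rw [Real.mul_rpow hC0 (norm_nonneg _)]
    calc ∑ i ∈ s, ‖y i‖ ^ p.toReal
        ≤ ∑ i ∈ s, C ^ p.toReal * ‖x (i + 1)‖ ^ p.toReal := by
          refine Finset.sum_le_sum fun i _ => ?_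
          rw [hy, norm_mul, Real.mul_rpow (norm_nonneg _) (norm_nonneg _)]
          gcongr
          exact hwC _
      _ = C ^ p.toReal * ∑ i ∈ s.map (addRightEmbedding 1), ‖x i‖ ^ p.toReal := by
          simp [Finset.mul_sum]
      _ ≤ C ^ p.toReal * ‖x‖ ^ p.toReal := by
          gcongr
          exact lp.sum_rpow_le_norm_rpow hp x _

/-- The unilateral weighted backward shift `B_w` on `ℓ^p`, `(B_w x)_n = w_{n+1} x_{n+1}`.
The canonical basis is indexed here as `e_0, e_1, e_2, …`, so that `B_w e_0 = 0` and
`B_w e_{n+1} = w_{n+1} e_n`; the weight `w_0` plays no role. -/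
def weightedShift (p : ℝ≥0∞) [Fact (1 ≤ p)] (w : ℕ → 𝕜) (hw : IsWeight w) :
    lp (fun _ : ℕ => 𝕜) p →L[𝕜] lp (fun _ : ℕ => 𝕜) p :=
  LinearMap.mkContinuousOfExistsBound
    { toFun := fun x => ⟨fun n => w (n + 1) * x (n + 1), weightedShift_memℓp hw (lp.memℓp x)⟩
      map_add' := fun x y => by ext n; exact mul_add _ _ _
      map_smul' := fun c x => by ext n; simp [mul_left_comm] }
    (by
      obtain ⟨C, hC⟩ := hw
      exact ⟨C, fun x => weightedShift_norm_le (fun n => hC ⟨n, rfl⟩) x _ fun n => rfl⟩)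

theorem weightedShift_apply (p : ℝ≥0∞) [Fact (1 ≤ p)] (w : ℕ → 𝕜) (hw : IsWeight w)
    (x : lp (fun _ : ℕ => 𝕜) p) (n : ℕ) :
    weightedShift p w hw x n = w (n + 1) * x (n + 1) := rfl

end WeightedShift

end

/-! Write each weight as a quotient `V n / V (n - 1)`, so that coordinate `0` of the `n`-th iterate
at `x` is `V n / V 0 * x n`. If `V` grows exponentially, a Baire argument with blocks planted at
multiples of a fixed `M` gives upper frequent hypercyclicity
(`isUpperFrequentlyHypercyclic_ratioWeight`).

For the pair, take products `V` and `V * R` with `R = 1` outside `⋃ k, [2 ^ k, 2 ^ k + k)`. This set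
has density zero, and off it both orbits of a common vector have the same coordinate `0`; so the
return times to a neighbourhood of a pair such as `(e₀, 3 e₀)` have density zero. But the set
contains arbitrarily long intervals. On the `k`-th one `R` follows a periodic pattern with code `k`,
every pattern recurring infinitely often. A suitable pattern makes the blocks aimed at two different
targets coincide, which gives return times of positive upper Banach density.

Large or small values of `R` are paid for by dividing both products by `2 ^ costSum n`. Since
`costSum n = o(n)`, exponential growth survives. -/

/-! ### Geometric estimates, a Baire criterion, densities -/

theorem sum_pow_le_of_forall_le {s : ℝ} (hs0 : 0 ≤ s) (hs1 : s < 1) (D : Finset ℕ) (a : ℕ)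
    (hD : ∀ d ∈ D, a ≤ d) : ∑ d ∈ D, s ^ d ≤ s ^ a / (1 - s) := by
  have hsum := summable_geometric_of_lt_one hs0 hs1
  have hinj : Set.InjOn (fun d => d - a) (D : Set ℕ) := by
    intro d hd e he h
    have := hD d hd
    have := hD e he
    simp only at h
    omega
  calc ∑ d ∈ D, s ^ d = s ^ a * ∑ d ∈ D, s ^ (d - a) := by
        rw [Finset.mul_sum]
        refine Finset.sum_congr rfl fun d hd => ?_
        rw [← pow_add, Nat.add_sub_cancel' (hD d hd)]
    _ = s ^ a * ∑ e ∈ D.image (fun d => d - a), s ^ e := by rw [Finset.sum_image hinj]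
    _ ≤ s ^ a * (1 - s)⁻¹ := by
        gcongr
        rw [← tsum_geometric_of_lt_one hs0 hs1]
        exact hsum.sum_le_tsum _ fun _ _ => by positivity
    _ = s ^ a / (1 - s) := by rw [div_eq_mul_inv]

/-- At time `d` the vector `z` and all earlier blocks are annihilated, block `d` hits its target,
and the later blocks leave a geometric tail. The same blocks `u` serve every `i`. -/
theorem norm_apply_add_sum_sub_le {ι 𝕜 X : Type*} [NontriviallyNormedField 𝕜]
    [NormedAddCommGroup X] [NormedSpace 𝕜 X] {S : ι → ℕ → X →L[𝕜] X} {y : ι → X} {u : ℕ → X}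
    {D : Finset ℕ} {z : X} {K s : ℝ} (hs0 : 0 ≤ s) (hs1 : s < 1) (hK : 0 ≤ K)
    (hdiag : ∀ i, ∀ d ∈ D, S i d (u d) = y i)
    (hup : ∀ i, ∀ d ∈ D, ∀ e ∈ D, d < e → ‖S i d (u e)‖ ≤ K * s ^ (e - d))
    (hlow : ∀ i, ∀ d ∈ D, ∀ e ∈ D, e < d → S i d (u e) = 0)
    (hz : ∀ i, ∀ d ∈ D, S i d z = 0) (i : ι) {d : ℕ} (hd : d ∈ D) :
    ‖S i d (z + ∑ e ∈ D, u e) - y i‖ ≤ K * (s / (1 - s)) := by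
  have h1 : S i d (z + ∑ e ∈ D, u e) - y i = ∑ e ∈ D.erase d, S i d (u e) := by
    rw [map_add, hz i d hd, zero_add, map_sum, ← Finset.add_sum_erase D _ hd, hdiag i d hd]
    abel
  have h2 : ∑ e ∈ D.erase d, S i d (u e) = ∑ e ∈ D with d < e, S i d (u e) := by
    symm
    refine Finset.sum_subset (fun e he => ?_) fun e he he' => ?_
    · simp only [Finset.mem_filter] at he
      exact Finset.mem_erase.2 ⟨by omega, he.1⟩
    · rw [Finset.mem_erase] at he
      refine hlow i d hd e he.2 ?_
      by_contra h
      exact he' (Finset.mem_filter.2 ⟨he.2, by omega⟩)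
  rw [h1, h2]
  calc ‖∑ e ∈ D with d < e, S i d (u e)‖
      ≤ ∑ e ∈ D with d < e, K * s ^ (e - d) := by
        refine norm_sum_le_of_le _ fun e he => ?_
        rw [Finset.mem_filter] at he
        exact hup i d hd e he.1 he.2
    _ = K * ∑ e ∈ (D.filter (d < ·)).image (fun e => e - d), s ^ e := by
        rw [Finset.sum_image, Finset.mul_sum]
        intro e he f hf h
        simp only [Finset.coe_filter, Set.mem_ofPred_eq] at he hf h
        omega
    _ ≤ K * (s / (1 - s)) := by
        gcongr
        refine (sum_pow_le_of_forall_le hs0 hs1 _ 1 ?_).trans (by rw [pow_one])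
        intro e he
        simp only [Finset.mem_image, Finset.mem_filter] at he
        obtain ⟨f, hf, rfl⟩ := he
        omega

/-- The sets are open because each `F` is finite, and a countable basis leaves countably many of
them. Since `δ` depends on `U` but not on `N`, it later bounds a limsup from below. -/
theorem exists_forall_isOpen_exists_finset_subset {X Y Δ : Type*} [TopologicalSpace X] [BaireSpace X]
    [Nonempty X] [TopologicalSpace Y] [SecondCountableTopology Y] {T : ℕ → X → Y}
    (hT : ∀ n, Continuous (T n)) (𝓕 : Δ → ℕ → Set (Finset ℕ))
    (h : ∀ U : Set Y, IsOpen U → U.Nonempty →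
      ∃ δ, ∀ N, Dense {x | ∃ F ∈ 𝓕 δ N, ∀ n ∈ F, T n x ∈ U}) :
    ∃ x, ∀ U : Set Y, IsOpen U → U.Nonempty →
      ∃ δ, ∀ N, ∃ F ∈ 𝓕 δ N, ∀ n ∈ F, T n x ∈ U := by
  let B := TopologicalSpace.countableBasis Y
  have hB := TopologicalSpace.isBasis_countableBasis Y
  have : Countable B := (TopologicalSpace.countable_countableBasis Y).to_subtype
  choose δ hδ using fun U : B => h U (hB.isOpen U.2) (TopologicalSpace.nonempty_of_mem_countableBasis U.2)
  have hopen : ∀ q : B × ℕ, IsOpen {x | ∃ F ∈ 𝓕 (δ q.1) q.2, ∀ n ∈ F, T n x ∈ (q.1 : Set Y)} := by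
    intro q
    have : {x | ∃ F ∈ 𝓕 (δ q.1) q.2, ∀ n ∈ F, T n x ∈ (q.1 : Set Y)} =
        ⋃ F ∈ 𝓕 (δ q.1) q.2, ⋂ n ∈ F, T n ⁻¹' (q.1 : Set Y) := by
      ext x
      simp
    rw [this]
    exact isOpen_biUnion fun F _ =>
      isOpen_biInter_finset fun n _ => (hB.isOpen q.1.2).preimage (hT n)
  obtain ⟨x, hx⟩ := (dense_iInter_of_isOpen hopen fun q => hδ q.1 q.2).nonempty
  rw [Set.mem_iInter] at hx
  refine ⟨x, fun U hU ⟨y, hy⟩ => ?_⟩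
  obtain ⟨V, hV, -, hVU⟩ := hB.exists_subset_of_mem_open hy hU
  refine ⟨δ ⟨V, hV⟩, fun N => ?_⟩
  obtain ⟨F, hF, hFx⟩ := hx (⟨V, hV⟩, N)
  exact ⟨F, hF, fun n hn => hVU (hFx n hn)⟩

theorem ncard_inter_Icc_div_le_one (A : Set ℕ) (k N : ℕ) :
    ((A ∩ Set.Icc (k + 1) (k + N)).ncard : ℝ) / (N : ℝ) ≤ 1 := by
  refine div_le_one_of_le₀ ?_ (Nat.cast_nonneg _)
  have h : (A ∩ Set.Icc (k + 1) (k + N)).ncard ≤ (Set.Icc (k + 1) (k + N)).ncard :=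
    Set.ncard_le_ncard Set.inter_subset_right (Set.finite_Icc _ _)
  have h2 : (Set.Icc (k + 1) (k + N)).ncard = N := by
    rw [← Finset.coe_Icc, Set.ncard_coe_finset, Nat.card_Icc]
    omega
  exact_mod_cast h.trans h2.le

theorem le_ncard_inter_Icc_div {A : Set ℕ} {F : Finset ℕ} {k N : ℕ} {δ : ℝ} (hN : 0 < N)
    (hF : (F : Set ℕ) ⊆ A ∩ Set.Icc (k + 1) (k + N)) (hδ : δ * N ≤ F.card) :
    δ ≤ ((A ∩ Set.Icc (k + 1) (k + N)).ncard : ℝ) / (N : ℝ) := by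
  rw [le_div_iff₀ (by positivity)]
  refine hδ.trans ?_
  rw [← Set.ncard_coe_finset F]
  exact_mod_cast Set.ncard_le_ncard hF ((Set.finite_Icc _ _).inter_of_right _)

/-- Finite sets filling a proportion `δ` of a window `[k + 1, k + n]` for some `n ≥ N`. -/
def denseInWindow (k : Set ℕ) (δ : Set.Ioi (0 : ℝ)) (N : ℕ) : Set (Finset ℕ) :=
  {F | ∃ n, N ≤ n ∧ 0 < n ∧ ∃ a ∈ k, (F : Set ℕ) ⊆ Set.Icc (a + 1) (a + n) ∧ (δ : ℝ) * n ≤ F.card}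

theorem mem_posUpperDensity {A : Set ℕ} (δ : Set.Ioi (0 : ℝ))
    (h : ∀ N, ∃ F ∈ denseInWindow {0} δ N, ∀ n ∈ F, n ∈ A) : A ∈ posUpperDensity := by
  have hδ : (0 : ℝ) < δ := δ.2
  refine hδ.trans_le (Filter.le_limsup_of_frequently_le ?_ ?_)
  · refine Filter.frequently_atTop.2 fun N => ?_
    obtain ⟨F, ⟨n, hNn, hn, a, rfl, hFI, hc⟩, hFA⟩ := h N
    refine ⟨n, hNn, ?_⟩
    simpa using le_ncard_inter_Icc_div (A := A) hn (Set.subset_inter hFA hFI) hc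
  · refine Filter.isBoundedUnder_of ⟨1, fun N => ?_⟩
    simpa using ncard_inter_Icc_div_le_one A 0 N

theorem mem_posUpperBanachDensity {A : Set ℕ} (δ : Set.Ioi (0 : ℝ))
    (h : ∀ N, ∃ F ∈ denseInWindow (Set.Ioi 0) δ N, ∀ n ∈ F, n ∈ A) : A ∈ posUpperBanachDensity := by
  have hδ : (0 : ℝ) < δ := δ.2
  refine hδ.trans_le (Filter.le_limsup_of_frequently_le ?_ ?_)
  · refine Filter.frequently_atTop.2 fun N => ?_
    obtain ⟨F, ⟨n, hNn, hn, a, ha, hFI, hc⟩, hFA⟩ := h N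
    refine ⟨n, hNn, (le_ncard_inter_Icc_div (A := A) hn (Set.subset_inter hFA hFI) hc).trans ?_⟩
    exact le_ciSup (f := fun k : ℕ+ =>
        ((A ∩ Set.Icc ((k : ℕ) + 1) ((k : ℕ) + n)).ncard : ℝ) / (n : ℝ))
      ⟨1, by rintro _ ⟨k, rfl⟩; exact ncard_inter_Icc_div_le_one A k n⟩ ⟨a, ha⟩
  · refine Filter.isBoundedUnder_of ⟨1, fun N => ?_⟩
    exact ciSup_le fun k => ncard_inter_Icc_div_le_one A k N

/-! ### Weighted shifts described by their partial products -/

section RatioWeight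

variable {𝕜 : Type*} [RCLike 𝕜]

/-- The weight sequence whose partial products are proportional to `V`. -/
noncomputable def ratioWeight (V : ℕ → 𝕜) (n : ℕ) : 𝕜 := V n / V (n - 1)

variable {p : ℝ≥0∞} [Fact (1 ≤ p)] {V : ℕ → 𝕜}

theorem weightedShift_ratioWeight_pow_apply (hV : ∀ n, V n ≠ 0) (hw : IsWeight (ratioWeight V))
    (n : ℕ) (x : lp (fun _ : ℕ => 𝕜) p) (j : ℕ) :
    (weightedShift p (ratioWeight V) hw ^ n) x j = V (j + n) / V j * x (j + n) := by
  induction n generalizing j with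
  | zero => simp [div_self (hV j)]
  | succ n ih =>
    rw [pow_succ', mul_apply_eq_comp, weightedShift_apply, ih, ratioWeight,
      Nat.add_sub_cancel, show j + 1 + n = j + (n + 1) by omega]
    have := hV j
    have := hV (j + 1)
    field_simp

theorem weightedShift_pow_single_of_lt (hV : ∀ n, V n ≠ 0) (hw : IsWeight (ratioWeight V))
    {n k : ℕ} (hk : k < n) (a : 𝕜) :
    (weightedShift p (ratioWeight V) hw ^ n) (lp.single p k a) = 0 := by
  ext j
  rw [weightedShift_ratioWeight_pow_apply hV, lp.single_apply_ne (E := fun _ => 𝕜) p k a (by omega)]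
  simp

theorem weightedShift_pow_single (hV : ∀ n, V n ≠ 0) (hw : IsWeight (ratioWeight V))
    (n k : ℕ) (a : 𝕜) :
    (weightedShift p (ratioWeight V) hw ^ n) (lp.single p (n + k) a) =
      lp.single p k (V (n + k) / V k * a) := by
  ext j
  rw [weightedShift_ratioWeight_pow_apply hV]
  rcases eq_or_ne j k with rfl | h
  · rw [add_comm j n, lp.single_apply_self, lp.single_apply_self]
  · rw [lp.single_apply_ne (E := fun _ => 𝕜) p k _ h,
      lp.single_apply_ne (E := fun _ => 𝕜) p (n + k) a (by omega), mul_zero]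

/-- The vector of `ℓ^p` supported in `[0, m)` where it agrees with `f`. -/
noncomputable def lpOfRange (p : ℝ≥0∞) (m : ℕ) (f : ℕ → 𝕜) : lp (fun _ : ℕ => 𝕜) p :=
  ∑ j ∈ Finset.range m, lp.single p j (f j)

theorem tendsto_lpOfRange (hp : p ≠ ∞) (x : lp (fun _ : ℕ => 𝕜) p) :
    Filter.Tendsto (fun m => lpOfRange p m x) Filter.atTop (nhds x) :=
  (lp.hasSum_single hp x).tendsto_sum_nat

theorem separableSpace_lp (hp : p ≠ ∞) :
    TopologicalSpace.SeparableSpace (lp (fun _ : ℕ => 𝕜) p) := by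
  have h : TopologicalSpace.IsSeparable (closure (Submodule.span 𝕜
      (Set.range fun j : ℕ => (lp.single p j (1 : 𝕜) : lp (fun _ : ℕ => 𝕜) p)) :
        Set (lp (fun _ : ℕ => 𝕜) p))) :=
    (Set.countable_range _).isSeparable.span.closure
  rw [← TopologicalSpace.isSeparable_univ_iff]
  refine h.mono fun x _ => ?_
  refine mem_closure_of_tendsto (tendsto_lpOfRange hp x) (Filter.Eventually.of_forall fun m => ?_)
  refine Submodule.sum_mem _ fun j _ => ?_
  have : lp.single p j (x j) = x j • (lp.single p j (1 : 𝕜) : lp (fun _ : ℕ => 𝕜) p) := by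
    rw [← lp.single_smul, smul_eq_mul, mul_one]
  rw [this]
  exact Submodule.smul_mem _ _ (Submodule.subset_span ⟨j, rfl⟩)

end RatioWeight

/-! ### Blocks, and upper frequent hypercyclicity from exponential growth -/

section ShiftedBlock

variable {𝕜 : Type*} [RCLike 𝕜] {p : ℝ≥0∞} {V : ℕ → 𝕜}

/-- The preimage of `lpOfRange p m Y` supported in `[n, n + m)` under the `n`-th power of the
weighted shift with weights `ratioWeight V`. -/
noncomputable def shiftedBlock (p : ℝ≥0∞) (V Y : ℕ → 𝕜) (m n : ℕ) : lp (fun _ : ℕ => 𝕜) p :=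
  ∑ j ∈ Finset.range m, lp.single p (n + j) (Y j * V j / V (n + j))

theorem shiftedBlock_zero (hV : ∀ n, V n ≠ 0) (Y : ℕ → 𝕜) (m : ℕ) :
    shiftedBlock p V Y m 0 = lpOfRange p m Y := by
  refine Finset.sum_congr rfl fun j _ => ?_
  rw [zero_add, mul_div_cancel_right₀ _ (hV j)]

variable [Fact (1 ≤ p)]

theorem weightedShift_pow_shiftedBlock (hV : ∀ n, V n ≠ 0) (hw : IsWeight (ratioWeight V))
    (Y : ℕ → 𝕜) (m a b : ℕ) :
    (weightedShift p (ratioWeight V) hw ^ a) (shiftedBlock p V Y m (a + b)) =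
      shiftedBlock p V Y m b := by
  rw [shiftedBlock, map_sum]
  refine Finset.sum_congr rfl fun j _ => ?_
  rw [add_assoc, weightedShift_pow_single hV]
  congr 1
  have := hV (a + (b + j))
  field_simp

theorem weightedShift_pow_shiftedBlock_eq_zero (hV : ∀ n, V n ≠ 0)
    (hw : IsWeight (ratioWeight V)) (Y : ℕ → 𝕜) {m n a : ℕ} (h : n + m ≤ a) :
    (weightedShift p (ratioWeight V) hw ^ a) (shiftedBlock p V Y m n) = 0 := by
  rw [shiftedBlock, map_sum]
  refine Finset.sum_eq_zero fun j hj => weightedShift_pow_single_of_lt hV hw ?_ _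
  have := Finset.mem_range.1 hj
  omega

theorem norm_shiftedBlock_le {c ρ : ℝ} (hc : 0 < c) (hρ0 : 0 < ρ) (hρ1 : ρ < 1)
    (hV : ∀ n, c ≤ ‖V n‖ * ρ ^ n) (Y : ℕ → 𝕜) (m n : ℕ) :
    ‖shiftedBlock p V Y m n‖ ≤ (∑ j ∈ Finset.range m, ‖Y j * V j‖ / c) * ρ ^ n := by
  rw [Finset.sum_mul]
  refine norm_sum_le_of_le _ fun j _ => ?_
  rw [lp.norm_single (zero_lt_one.trans_le Fact.out), norm_div]
  have h1 := hV (n + j)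
  have hpos : 0 < ‖V (n + j)‖ :=
    pos_of_mul_pos_left (hc.trans_le h1) (by positivity)
  have h2 : c ≤ ‖V (n + j)‖ * ρ ^ n :=
    h1.trans (mul_le_mul_of_nonneg_left
      (pow_le_pow_of_le_one hρ0.le hρ1.le (by omega)) hpos.le)
  rw [div_mul_eq_mul_div, div_le_div_iff₀ hpos hc, mul_assoc, mul_comm (ρ ^ n)]
  exact mul_le_mul_of_nonneg_left h2 (norm_nonneg _)

theorem weightedShift_pow_lpOfRange_eq_zero (hV : ∀ n, V n ≠ 0)
    (hw : IsWeight (ratioWeight V)) (Y : ℕ → 𝕜) {m a : ℕ} (h : m ≤ a) :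
    (weightedShift p (ratioWeight V) hw ^ a) (lpOfRange p m Y) = 0 := by
  rw [← shiftedBlock_zero hV]
  exact weightedShift_pow_shiftedBlock_eq_zero hV hw Y (by omega)

/-- The compatibility condition says that the preimages of the targets under the different shifts
are one and the same block. The spacing `M` is fixed before `x₀` and `η`, so the density of hitting
times depends only on the target. -/
theorem exists_forall_norm_pow_sub_lt (hp : p ≠ ∞) {ι : Type*} [Fintype ι] [Nonempty ι]
    {V : ι → ℕ → 𝕜} (hw : ∀ i, IsWeight (ratioWeight (V i))) {c ρ : ℝ} (hc : 0 < c) (hρ0 : 0 < ρ)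
    (hρ1 : ρ < 1) (hVρ : ∀ i n, c ≤ ‖V i n‖ * ρ ^ n) (Y : ι → ℕ → 𝕜) (m : ℕ) {ε : ℝ}
    (hε : 0 < ε) :
    ∃ M, m ≤ M ∧ 0 < M ∧ ∀ (x₀ : lp (fun _ : ℕ => 𝕜) p) (η : ℝ), 0 < η → ∃ d₀, ∀ D : Finset ℕ,
      (∀ d ∈ D, d₀ ≤ d) →
      (∀ d ∈ D, ∀ j < m, ∀ i i', Y i j * V i j / V i (d * M + j) =
        Y i' j * V i' j / V i' (d * M + j)) →
      ∃ x : lp (fun _ : ℕ => 𝕜) p, ‖x - x₀‖ < η ∧ ∀ i, ∀ d ∈ D,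
        ‖(weightedShift p (ratioWeight (V i)) (hw i) ^ (d * M)) x - lpOfRange p m (Y i)‖ < ε := by
  have hV : ∀ i n, V i n ≠ 0 := by
    intro i n h
    have := hVρ i n
    rw [h, norm_zero, zero_mul] at this
    linarith
  set K : ℝ := ∑ i, ∑ j ∈ Finset.range m, ‖Y i j * V i j‖ / c with hKdef
  have hK : 0 ≤ K := Finset.sum_nonneg fun i _ => Finset.sum_nonneg fun j _ => by positivity
  have hnorm : ∀ i n, ‖shiftedBlock p (V i) (Y i) m n‖ ≤ K * ρ ^ n := by
    intro i n
    refine (norm_shiftedBlock_le hc hρ0 hρ1 (hVρ i) (Y i) m n).trans ?_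
    gcongr
    exact Finset.single_le_sum (f := fun i => ∑ j ∈ Finset.range m, ‖Y i j * V i j‖ / c)
      (fun i _ => Finset.sum_nonneg fun j _ => by positivity) (Finset.mem_univ i)
  have hρlim := tendsto_pow_atTop_nhds_zero_of_lt_one hρ0.le hρ1
  have hlim : Filter.Tendsto (fun M : ℕ => K * (ρ ^ M / (1 - ρ ^ M))) Filter.atTop (nhds 0) := by
    have := (hρlim.div (hρlim.const_sub 1) (by norm_num)).const_mul K
    simpa using this
  -- `M ≥ m` keeps the blocks disjoint; the other condition makes the tail of later blocks less than
  -- `ε`.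
  obtain ⟨M, hM, hmM, hM0⟩ := ((hlim.eventually (gt_mem_nhds hε)).and
    ((Filter.eventually_ge_atTop m).and (Filter.eventually_gt_atTop 0))).exists
  refine ⟨M, hmM, hM0, fun x₀ η hη => ?_⟩
  have hs0 : 0 < ρ ^ M := by positivity
  have hs1 : ρ ^ M < 1 := pow_lt_one₀ hρ0.le hρ1 hM0.ne'
  have hlim2 : Filter.Tendsto (fun d : ℕ => K * ((ρ ^ M) ^ d / (1 - ρ ^ M))) Filter.atTop
      (nhds 0) := by
    simpa using ((tendsto_pow_atTop_nhds_zero_of_lt_one hs0.le hs1).div_const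
      (1 - ρ ^ M)).const_mul K
  obtain ⟨m₀, hm₀⟩ := ((tendsto_lpOfRange hp x₀).eventually
    (Metric.ball_mem_nhds x₀ (half_pos hη))).exists
  rw [dist_eq_norm] at hm₀
  -- Late blocks have small total norm, and `d₀ ≥ m₀` ensures that the truncation of `x₀` is killed
  -- at time `d * M`.
  obtain ⟨d₀, hd₀, hd₀m⟩ := ((hlim2.eventually (gt_mem_nhds (half_pos hη))).and
    (Filter.eventually_ge_atTop m₀)).exists
  refine ⟨d₀, fun D hD hcompat => ?_⟩
  obtain ⟨i₀⟩ := ‹Nonempty ι›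
  have hu : ∀ d ∈ D, ∀ i, shiftedBlock p (V i₀) (Y i₀) m (d * M) =
      shiftedBlock p (V i) (Y i) m (d * M) := by
    intro d hd i
    refine Finset.sum_congr rfl fun j hj => ?_
    rw [hcompat d hd j (Finset.mem_range.1 hj) i₀ i]
  refine ⟨lpOfRange p m₀ x₀ + ∑ d ∈ D, shiftedBlock p (V i₀) (Y i₀) m (d * M), ?_, ?_⟩
  · have h1 : ‖∑ d ∈ D, shiftedBlock p (V i₀) (Y i₀) m (d * M)‖ < η / 2 := by
      refine lt_of_le_of_lt ?_ hd₀
      calc _ ≤ ∑ d ∈ D, K * (ρ ^ M) ^ d := by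
            refine norm_sum_le_of_le _ fun d _ => ?_
            rw [← pow_mul, mul_comm M]
            exact hnorm i₀ _
        _ ≤ _ := by
            rw [← Finset.mul_sum]
            gcongr
            exact sum_pow_le_of_forall_le hs0.le hs1 D d₀ hD
    rw [add_sub_right_comm]
    linarith [norm_add_le (lpOfRange p m₀ x₀ - x₀)
      (∑ d ∈ D, shiftedBlock p (V i₀) (Y i₀) m (d * M))]
  · intro i d hd
    refine lt_of_le_of_lt ?_ hM
    refine norm_apply_add_sum_sub_le
      (S := fun i d => weightedShift p (ratioWeight (V i)) (hw i) ^ (d * M))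
      (y := fun i => lpOfRange p m (Y i)) hs0.le hs1 hK ?_ ?_ ?_ ?_ i hd
    · intro i d hd
      rw [hu d hd i, ← shiftedBlock_zero (hV i) (Y i) m]
      exact weightedShift_pow_shiftedBlock (hV i) (hw i) (Y i) m (d * M) 0
    · intro i d _ e he hde
      obtain ⟨b, rfl⟩ := Nat.exists_eq_add_of_lt hde
      rw [hu _ he i, show (d + b + 1) * M = d * M + (b + 1) * M by ring]
      rw [weightedShift_pow_shiftedBlock (hV i) (hw i), ← pow_mul,
        show d + b + 1 - d = b + 1 by omega, mul_comm M]
      exact hnorm i _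
    · intro i d _ e he hed
      rw [hu _ he i]
      refine weightedShift_pow_shiftedBlock_eq_zero (hV i) (hw i) (Y i) ?_
      calc e * M + m ≤ e * M + M := by omega
        _ = (e + 1) * M := by ring
        _ ≤ d * M := Nat.mul_le_mul_right _ hed
    · intro i d hd
      refine weightedShift_pow_lpOfRange_eq_zero (hV i) (hw i) _ ?_
      have := hD d hd
      nlinarith

theorem isUpperFrequentlyHypercyclic_ratioWeight (hp : p ≠ ∞)
    (hw : IsWeight (ratioWeight V)) {c ρ : ℝ} (hc : 0 < c) (hρ0 : 0 < ρ)
    (hρ1 : ρ < 1) (hVρ : ∀ n, c ≤ ‖V n‖ * ρ ^ n) :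
    IsUpperFrequentlyHypercyclic (weightedShift p (ratioWeight V) hw) := by
  have := separableSpace_lp (𝕜 := 𝕜) hp
  have : SecondCountableTopology (lp (fun _ : ℕ => 𝕜) p) :=
    UniformSpace.secondCountable_of_separable _
  suffices h : ∀ U : Set (lp (fun _ : ℕ => 𝕜) p), IsOpen U → U.Nonempty →
      ∃ δ, ∀ N, Dense {x | ∃ F ∈ denseInWindow {0} δ N, ∀ n ∈ F,
        (weightedShift p (ratioWeight V) hw ^ n) x ∈ U} by
    obtain ⟨x, hx⟩ := exists_forall_isOpen_exists_finset_subset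
      (fun n => (weightedShift p (ratioWeight V) hw ^ n).continuous) (denseInWindow {0}) h
    refine ⟨x, fun U hU hne => ?_⟩
    obtain ⟨δ, hδ⟩ := hx U hU hne
    exact mem_posUpperDensity δ hδ
  rintro U hU ⟨y, hy⟩
  obtain ⟨m, hm⟩ := ((tendsto_lpOfRange hp y).eventually (hU.mem_nhds hy)).exists
  obtain ⟨ε, hε, hεU⟩ := Metric.isOpen_iff.1 hU _ hm
  obtain ⟨M, -, hM0, hM⟩ := exists_forall_norm_pow_sub_lt (ι := Unit) hp (fun _ => hw) hc hρ0 hρ1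
    (fun _ => hVρ) (fun _ => y) m hε
  have hMR : (0 : ℝ) < M := by exact_mod_cast hM0
  refine ⟨⟨1 / (2 * M), by rw [Set.mem_Ioi]; positivity⟩, fun N => Metric.dense_iff.2 fun x₀ η hη => ?_⟩
  obtain ⟨d₀, hd₀⟩ := hM x₀ η hη
  -- The window `[1, 2 * e * M]` contains the `e + 1` hitting times `d * M`, a proportion above `1 /
  -- (2 * M)`.
  set e := d₀ + N + 1
  obtain ⟨x, hx, hxD⟩ := hd₀ (Finset.Icc e (2 * e)) (fun d hd => by
    have := (Finset.mem_Icc.1 hd).1; omega) (fun _ _ _ _ _ _ => rfl)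
  refine ⟨x, by rwa [Metric.mem_ball, dist_eq_norm], (Finset.Icc e (2 * e)).image (· * M),
    ⟨2 * e * M, ?_, by positivity, 0, rfl, ?_, ?_⟩, ?_⟩
  · calc N ≤ 2 * e * 1 := by omega
      _ ≤ 2 * e * M := Nat.mul_le_mul_left _ hM0
  · intro n hn
    simp only [Finset.coe_image, Set.mem_image, Finset.coe_Icc, Set.mem_Icc] at hn ⊢
    obtain ⟨d, hd, rfl⟩ := hn
    have : 0 < d * M := Nat.mul_pos (by omega) hM0
    have : d * M ≤ 2 * e * M := Nat.mul_le_mul_right _ hd.2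
    omega
  · rw [Finset.card_image_of_injective _ (mul_left_injective₀ hM0.ne'), Nat.card_Icc]
    rw [show 2 * e + 1 - e = e + 1 by omega]
    push_cast
    field_simp
    linarith
  · intro n hn
    obtain ⟨d, hd, rfl⟩ := Finset.mem_image.1 hn
    exact hεU (by rw [Metric.mem_ball, dist_eq_norm]; exact hxD () d hd)

end ShiftedBlock

/-! ### The sparse set and its cost -/

/-- Membership in the sparse set `⋃ k, [2 ^ k, 2 ^ k + k)`. -/
def IsSparseTime (n : ℕ) : Prop := n - 2 ^ Nat.log 2 n < Nat.log 2 n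

open scoped Classical in
/-- The cost `k` on `[2 ^ k, 2 ^ k + k)`, and `0` off these intervals. -/
noncomputable def sparseCost (n : ℕ) : ℕ := if IsSparseTime n then Nat.log 2 n else 0

/-- The partial sums of `sparseCost`. -/
noncomputable def costSum (n : ℕ) : ℕ := ∑ i ∈ Finset.range n, sparseCost i

theorem costSum_mono : Monotone costSum := fun _ _ h =>
  Finset.sum_le_sum_of_subset (Finset.range_mono h)

theorem costSum_succ (n : ℕ) : costSum (n + 1) = costSum n + sparseCost n :=
  Finset.sum_range_succ _ _

theorem log_two_pow_add {k j : ℕ} (hj : j < 2 ^ k) : Nat.log 2 (2 ^ k + j) = k :=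
  Nat.log_eq_of_pow_le_of_lt_pow (by omega) (by rw [pow_succ]; omega)

theorem isSparseTime_two_pow_add {k j : ℕ} (hj : j < k) : IsSparseTime (2 ^ k + j) := by
  rw [IsSparseTime, log_two_pow_add (hj.trans k.lt_two_pow_self)]
  omega

/-- The dyadic block `[2 ^ k, 2 ^ (k + 1))` holds at most `k` sparse times of cost `k`, and `k ^ 3 +
k ^ 2 ≤ (k + 1) ^ 3`. -/
theorem costSum_two_pow_le (k : ℕ) : costSum (2 ^ k) ≤ k ^ 3 := by
  induction k with
  | zero => simp [costSum, sparseCost, IsSparseTime]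
  | succ k ih =>
    have h : ∑ j ∈ Finset.range (2 ^ k), sparseCost (2 ^ k + j) ≤ k * k := by
      calc ∑ j ∈ Finset.range (2 ^ k), sparseCost (2 ^ k + j)
          ≤ ∑ j ∈ Finset.range (2 ^ k), if j ∈ Finset.range k then k else 0 := by
            refine Finset.sum_le_sum fun j hj => ?_
            rw [sparseCost, IsSparseTime, log_two_pow_add (Finset.mem_range.1 hj),
              Nat.add_sub_cancel_left]
            simp only [Finset.mem_range]
            split_ifs <;> exact le_rfl
        _ = ((Finset.range (2 ^ k)) ∩ Finset.range k).card * k := by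
            rw [Finset.sum_ite_mem, Finset.sum_const, smul_eq_mul]
        _ ≤ k * k := by
            gcongr
            exact (Finset.card_le_card Finset.inter_subset_right).trans (Finset.card_range k).le
    rw [costSum, pow_succ, mul_two, Finset.sum_range_add]
    change costSum (2 ^ k) + _ ≤ _
    nlinarith

theorem costSum_le (n : ℕ) : costSum n ≤ (Nat.log 2 n + 1) ^ 3 :=
  (costSum_mono (Nat.lt_pow_succ_log_self one_lt_two n).le).trans (costSum_two_pow_le _)

theorem tendsto_costSum_div : Filter.Tendsto (fun n : ℕ => (costSum n : ℝ) / n) Filter.atTop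
    (nhds 0) := by
  have hlog : Filter.Tendsto (Nat.log 2) Filter.atTop Filter.atTop :=
    Filter.tendsto_atTop_atTop.2 fun b => ⟨2 ^ b, fun a ha => by
      rw [← Nat.log_pow one_lt_two b]; exact Nat.log_mono_right ha⟩
  have h := ((tendsto_pow_const_div_const_pow_of_one_lt 3 (r := (2 : ℝ)) one_lt_two).comp
    (Filter.tendsto_add_atTop_nat 1)).const_mul 2
  rw [mul_zero] at h
  refine squeeze_zero' (Filter.Eventually.of_forall fun n => by positivity) ?_ (h.comp hlog)
  filter_upwards [Filter.eventually_gt_atTop 0] with n hn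
  have h1 : (costSum n : ℝ) ≤ (Nat.log 2 n + 1 : ℝ) ^ 3 := by exact_mod_cast costSum_le n
  have h2 : (2 : ℝ) ^ Nat.log 2 n ≤ n := by exact_mod_cast Nat.pow_log_le_self 2 hn.ne'
  calc (costSum n : ℝ) / n ≤ (Nat.log 2 n + 1 : ℝ) ^ 3 / 2 ^ Nat.log 2 n := by gcongr
    _ = _ := by
      simp only [Function.comp_apply, pow_succ (2 : ℝ)]
      push_cast
      field_simp

theorem exists_two_mul_costSum_le : ∃ B, ∀ n, 2 * costSum (n + 1) ≤ n + 2 * B := by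
  obtain ⟨n₀, hn₀⟩ := Filter.eventually_atTop.1
    (tendsto_costSum_div.eventually (gt_mem_nhds (show (0 : ℝ) < 1 / 4 by norm_num)))
  refine ⟨costSum (n₀ + 2), fun n => ?_⟩
  rcases le_total n (n₀ + 1) with h | h
  · have := costSum_mono (show n + 1 ≤ n₀ + 2 by omega)
    omega
  · have h1 := hn₀ (n + 1) (by omega)
    rw [div_lt_iff₀ (by positivity)] at h1
    have h2 : 4 * costSum (n + 1) < n + 1 := by
      have : (4 * costSum (n + 1) : ℝ) < ((n + 1 : ℕ) : ℝ) := by linarith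
      exact_mod_cast this
    omega

/-- Every sparse time costs at least `1`, so `costSum` dominates the counting function. -/
theorem upperDensity_nonpos_of_subset_isSparseTime {A : Set ℕ} (hA : ∀ n ∈ A, IsSparseTime n) :
    upperDensity A ≤ 0 := by
  have hlim : Filter.Tendsto (fun N : ℕ => ((A ∩ Set.Icc 1 N).ncard : ℝ) / (N : ℝ)) Filter.atTop
      (nhds 0) := by
    have h := (tendsto_costSum_div.comp (Filter.tendsto_add_atTop_nat 1)).const_mul 2
    rw [mul_zero] at h
    refine squeeze_zero' (Filter.Eventually.of_forall fun n => by positivity) ?_ h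
    filter_upwards [Filter.eventually_gt_atTop 0] with N hN
    have h1 : (A ∩ Set.Icc 1 N).ncard ≤ costSum (N + 1) := by
      classical
      have hsub : A ∩ Set.Icc 1 N ⊆ ((Finset.range (N + 1)).filter IsSparseTime : Finset ℕ) := by
        intro n hn
        simp only [Finset.coe_filter, Finset.mem_range, Set.mem_ofPred_eq]
        exact ⟨Nat.lt_succ_of_le hn.2.2, hA n hn.1⟩
      refine (Set.ncard_le_ncard hsub (Finset.finite_toSet _)).trans ?_
      rw [Set.ncard_coe_finset, Finset.card_filter]
      refine Finset.sum_le_sum fun n _ => ?_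
      rw [sparseCost]
      split_ifs with h
      · exact Nat.one_le_iff_ne_zero.2 fun h0 => by rw [IsSparseTime, h0] at h; omega
      · exact le_rfl
    have hN1 : (1 : ℝ) ≤ N := by exact_mod_cast hN
    have h2 : ((A ∩ Set.Icc 1 N).ncard : ℝ) ≤ costSum (N + 1) := by exact_mod_cast h1
    simp only [Function.comp_apply]
    rw [← mul_div_assoc, div_le_div_iff₀ (by positivity) (by positivity)]
    push_cast
    have : (0 : ℝ) ≤ costSum (N + 1) := by positivity
    nlinarith
  exact hlim.limsup_eq.le

/-! ### Damped powers of two: bounded weights, exponential growth -/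

section Weights

variable {𝕜 : Type*} [RCLike 𝕜]

/-- The sequence `2 ^ n`, damped at the sparse times and multiplied by `A`. -/
noncomputable def dampedPow (A : ℕ → 𝕜) (n : ℕ) : 𝕜 := 2 ^ n / 2 ^ costSum n * A n

theorem norm_dampedPow (A : ℕ → 𝕜) (n : ℕ) :
    ‖dampedPow A n‖ = 2 ^ n / 2 ^ costSum n * ‖A n‖ := by
  simp [dampedPow]

/-- From `A n` to `A (n + 1)` the norm grows by a factor at most `2 ^ sparseCost n`, which is
exactly the damping gained from `costSum` at that step. -/
theorem isWeight_ratioWeight_dampedPow {A : ℕ → 𝕜} (hA1 : ∀ n, ‖A n‖ ≤ 1)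
    (hA2 : ∀ n, 1 ≤ ‖A n‖ * 2 ^ sparseCost n) : IsWeight (ratioWeight (dampedPow A)) := by
  refine ⟨2, ?_⟩
  rintro _ ⟨n, rfl⟩
  cases n with
  | zero =>
    simp only [ratioWeight, zero_tsub, norm_div]
    exact (div_self_le_one _).trans one_le_two
  | succ n =>
    have hpos : 0 < ‖A n‖ := pos_of_mul_pos_left (one_pos.trans_le (hA2 n)) (by positivity)
    simp only [ratioWeight, Nat.add_sub_cancel, norm_div, norm_dampedPow]
    rw [div_le_iff₀ (by positivity), costSum_succ, pow_add, pow_add, pow_one]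
    calc (2 : ℝ) ^ n * 2 / (2 ^ costSum n * 2 ^ sparseCost n) * ‖A (n + 1)‖
        ≤ 2 ^ n * 2 / (2 ^ costSum n * 2 ^ sparseCost n) * (‖A n‖ * 2 ^ sparseCost n) := by
          gcongr
          exact (hA1 _).trans (hA2 n)
      _ = 2 * (2 ^ n / 2 ^ costSum n * ‖A n‖) := by field_simp

end Weights

theorem exists_le_norm_dampedPow (𝕜 : Type*) [RCLike 𝕜] : ∃ c : ℝ, 0 < c ∧ ∀ {A : ℕ → 𝕜},
    (∀ n, 1 ≤ ‖A n‖ * 2 ^ sparseCost n) → ∀ n, c ≤ ‖dampedPow A n‖ * (3 / 4) ^ n := by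
  obtain ⟨B, hB⟩ := exists_two_mul_costSum_le
  refine ⟨(2 ^ B)⁻¹, by positivity, fun {A} hA n => ?_⟩
  -- The damping is at most `2 ^ B * √2 ^ n`, and `√2 ≤ 3 / 2 = 2 * (3 / 4)`.
  have h1 : (2 : ℝ) ^ costSum (n + 1) ≤ 2 ^ B * (3 / 2) ^ n := by
    refine le_of_sq_le_sq ?_ (by positivity)
    calc ((2 : ℝ) ^ costSum (n + 1)) ^ 2 = 2 ^ (2 * costSum (n + 1)) := by rw [← pow_mul, mul_comm]
      _ ≤ 2 ^ (n + 2 * B) := pow_le_pow_right₀ one_le_two (hB n)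
      _ = 2 ^ n * (2 ^ B) ^ 2 := by rw [pow_add, ← pow_mul, mul_comm B]
      _ ≤ (9 / 4) ^ n * (2 ^ B) ^ 2 := by gcongr; norm_num
      _ = (2 ^ B * (3 / 2) ^ n) ^ 2 := by
        rw [mul_pow, ← pow_mul (3 / 2 : ℝ), mul_comm n 2, pow_mul (3 / 2 : ℝ), mul_comm]
        norm_num
  rw [norm_dampedPow]
  calc ((2 : ℝ) ^ B)⁻¹ ≤ (3 / 2) ^ n / 2 ^ costSum (n + 1) := by
        rw [inv_eq_one_div, div_le_div_iff₀ (by positivity) (by positivity)]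
        linarith
    _ = (3 / 2) ^ n / (2 ^ costSum n * 2 ^ sparseCost n) * 1 := by
        rw [costSum_succ, pow_add, mul_one]
    _ ≤ (3 / 2) ^ n / (2 ^ costSum n * 2 ^ sparseCost n) * (‖A n‖ * 2 ^ sparseCost n) := by
        gcongr
        exact hA n
    _ = 2 ^ n / 2 ^ costSum n * ‖A n‖ * (3 / 4) ^ n := by
        rw [show (3 / 2 : ℝ) = 2 * (3 / 4) by norm_num, mul_pow]
        field_simp

/-! ### The quotient of the two products and its periodic patterns -/

section Pattern

variable (𝕜 : Type*) [RCLike 𝕜]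

/-- An enumeration of the pairs of a finite list and a period, each occurring infinitely often. -/
def patternCode (k : ℕ) : List ℕ × ℕ :=
  ((Denumerable.ofNat (List ℕ × ℕ × ℕ) k).1, (Denumerable.ofNat (List ℕ × ℕ × ℕ) k).2.1)

/-- The third component of the enumerated triples is a dummy counter. -/
theorem frequently_patternCode_eq (q : List ℕ × ℕ) :
    ∃ᶠ k in Filter.atTop, patternCode k = q := by
  rw [Nat.frequently_atTop_iff_infinite]
  refine Set.infinite_of_injective_forall_mem
    (f := fun i : ℕ => Encodable.encode (q.1, q.2, i)) (fun i j h => ?_) fun i => ?_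
  · simpa using h
  · simp [patternCode]

/-- The value at time `n` of the periodic pattern with code `Nat.log 2 n`. -/
noncomputable def patternValue (n : ℕ) : 𝕜 :=
  TopologicalSpace.denseSeq 𝕜
    ((patternCode (Nat.log 2 n)).1.getD (n % (patternCode (Nat.log 2 n)).2) 0)

open scoped Classical in
/-- The prescribed quotient of the partial products of the two weights. -/
noncomputable def patternRatio (n : ℕ) : 𝕜 :=
  if IsSparseTime n ∧ patternValue 𝕜 n ≠ 0 ∧ ‖patternValue 𝕜 n‖ ≤ 2 ^ Nat.log 2 n ∧
    ‖patternValue 𝕜 n‖⁻¹ ≤ 2 ^ Nat.log 2 n then patternValue 𝕜 n else 1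

theorem patternRatio_of_not_isSparseTime {n : ℕ} (hn : ¬ IsSparseTime n) :
    patternRatio 𝕜 n = 1 := if_neg fun h => hn h.1

theorem patternRatio_ne_zero (n : ℕ) : patternRatio 𝕜 n ≠ 0 := by
  rw [patternRatio]
  split_ifs with h
  · exact h.2.1
  · exact one_ne_zero

theorem norm_patternRatio_le (n : ℕ) : ‖patternRatio 𝕜 n‖ ≤ 2 ^ sparseCost n := by
  rw [patternRatio, sparseCost]
  split_ifs with h h' h'
  · exact h.2.2.1
  · exact absurd h.1 h'
  · simpa using one_le_pow₀ (one_le_two (α := ℝ))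
  · simp

theorem inv_norm_patternRatio_le (n : ℕ) : ‖patternRatio 𝕜 n‖⁻¹ ≤ 2 ^ sparseCost n := by
  rw [patternRatio, sparseCost]
  split_ifs with h h' h'
  · exact h.2.2.2
  · exact absurd h.1 h'
  · simpa using one_le_pow₀ (one_le_two (α := ℝ))
  · simp

/-- The damping factor of the first weight. -/
noncomputable def patternFactor (n : ℕ) : 𝕜 := ((max 1 ‖patternRatio 𝕜 n‖)⁻¹ : ℝ)

theorem norm_patternFactor (n : ℕ) : ‖patternFactor 𝕜 n‖ = (max 1 ‖patternRatio 𝕜 n‖)⁻¹ := by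
  rw [patternFactor, RCLike.norm_ofReal, abs_of_nonneg (by positivity)]

theorem patternFactor_bounds (n : ℕ) :
    ‖patternFactor 𝕜 n‖ ≤ 1 ∧ 1 ≤ ‖patternFactor 𝕜 n‖ * 2 ^ sparseCost n := by
  have h1 : 1 ≤ max 1 ‖patternRatio 𝕜 n‖ := le_max_left _ _
  rw [norm_patternFactor]
  refine ⟨inv_le_one_of_one_le₀ h1, ?_⟩
  rw [inv_mul_eq_div, one_le_div (by positivity)]
  exact max_le (one_le_pow₀ one_le_two) (norm_patternRatio_le 𝕜 n)

/-- Dividing by `max 1 ‖R‖` keeps both factors, `1` and `R`, at norm at most `1`. The size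
restrictions on `R` and `R⁻¹` in `patternRatio` give the lower bounds; any fixed nonzero value meets
them for large `k`. -/
theorem patternFactor_mul_patternRatio_bounds (n : ℕ) :
    ‖patternFactor 𝕜 n * patternRatio 𝕜 n‖ ≤ 1 ∧
      1 ≤ ‖patternFactor 𝕜 n * patternRatio 𝕜 n‖ * 2 ^ sparseCost n := by
  have h0 : 0 < ‖patternRatio 𝕜 n‖ := norm_pos_iff.2 (patternRatio_ne_zero 𝕜 n)
  have h1 : 1 ≤ max 1 ‖patternRatio 𝕜 n‖ := le_max_left _ _
  have h2 := inv_norm_patternRatio_le 𝕜 n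
  rw [inv_le_iff_one_le_mul₀ h0] at h2
  rw [norm_mul, norm_patternFactor, inv_mul_eq_div]
  refine ⟨div_le_one_of_le₀ (le_max_right _ _) (by positivity), ?_⟩
  rw [div_mul_eq_mul_div, one_le_div (by positivity)]
  refine max_le (by linarith) ?_
  exact le_mul_of_one_le_right h0.le (one_le_pow₀ one_le_two)

/-- The partial products of the two weights. -/
noncomputable def patternProducts : Fin 2 → ℕ → 𝕜 :=
  ![dampedPow (patternFactor 𝕜), dampedPow fun n => patternFactor 𝕜 n * patternRatio 𝕜 n]

theorem patternProducts_one (n : ℕ) :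
    patternProducts 𝕜 1 n = patternProducts 𝕜 0 n * patternRatio 𝕜 n := by
  simp [patternProducts, dampedPow, mul_assoc]

theorem isWeight_patternProducts (i : Fin 2) : IsWeight (ratioWeight (patternProducts 𝕜 i)) := by
  fin_cases i
  · exact isWeight_ratioWeight_dampedPow (fun n => (patternFactor_bounds 𝕜 n).1)
      fun n => (patternFactor_bounds 𝕜 n).2
  · exact isWeight_ratioWeight_dampedPow (fun n => (patternFactor_mul_patternRatio_bounds 𝕜 n).1)
      fun n => (patternFactor_mul_patternRatio_bounds 𝕜 n).2

theorem exists_le_norm_patternProducts :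
    ∃ c : ℝ, 0 < c ∧ ∀ i n, c ≤ ‖patternProducts 𝕜 i n‖ * (3 / 4) ^ n := by
  obtain ⟨c, hc, h⟩ := exists_le_norm_dampedPow 𝕜
  refine ⟨c, hc, fun i => ?_⟩
  fin_cases i
  · exact h fun n => (patternFactor_bounds 𝕜 n).2
  · exact h fun n => (patternFactor_mul_patternRatio_bounds 𝕜 n).2

theorem patternProducts_ne_zero (i : Fin 2) (n : ℕ) : patternProducts 𝕜 i n ≠ 0 := by
  obtain ⟨c, hc, h⟩ := exists_le_norm_patternProducts 𝕜
  intro h0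
  have := h i n
  rw [h0, norm_zero, zero_mul] at this
  linarith

theorem patternRatio_two_pow_add {k r M : ℕ} {σ : List ℕ} (hr : r < k)
    (hcode : patternCode k = (σ, M)) {d : 𝕜} (hd : d ≠ 0) (hd1 : ‖d‖ ≤ 2 ^ k)
    (hd2 : ‖d‖⁻¹ ≤ 2 ^ k)
    (h : TopologicalSpace.denseSeq 𝕜 (σ.getD ((2 ^ k + r) % M) 0) = d) :
    patternRatio 𝕜 (2 ^ k + r) = d := by
  have hlog := log_two_pow_add (hr.trans k.lt_two_pow_self)
  have hv : patternValue 𝕜 (2 ^ k + r) = d := by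
    rw [patternValue, hlog, hcode]
    exact h
  rw [patternRatio, hv, hlog, if_pos ⟨isSparseTime_two_pow_add hr, hd, hd1, hd2⟩]

variable {𝕜}

/-- Once both coordinates are nonzero, a small change of the second one alone puts `q.2 * r / q.1`
exactly in the dense sequence. -/
theorem dense_setOf_exists_denseSeq {r : 𝕜} (hr : r ≠ 0) :
    Dense {q : 𝕜 × 𝕜 | ∃ l, TopologicalSpace.denseSeq 𝕜 l ≠ 0 ∧
      q.2 * r = q.1 * TopologicalSpace.denseSeq 𝕜 l} := by
  rw [dense_iff_inter_open]
  intro O hO hne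
  obtain ⟨q, hqO, hq⟩ := ((dense_compl_singleton (0 : 𝕜)).prod
    (dense_compl_singleton (0 : 𝕜))).inter_open_nonempty O hO hne
  have hq1 : q.1 ≠ 0 := hq.1
  have hq2 : q.2 ≠ 0 := hq.2
  have hf : Continuous fun t : 𝕜 => ((q.1, q.1 * t / r) : 𝕜 × 𝕜) := by fun_prop
  obtain ⟨l, hl, hl0⟩ := (TopologicalSpace.denseRange_denseSeq 𝕜).exists_mem_open
    ((hO.preimage hf).inter (isOpen_compl_singleton (x := (0 : 𝕜))))
    ⟨q.2 * r / q.1, by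
      have : q.1 * (q.2 * r / q.1) / r = q.2 := by field_simp
      simpa [this] using hqO, by
      exact div_ne_zero (mul_ne_zero hq2 hr) hq1⟩
  exact ⟨_, hl, l, hl0, by field_simp⟩

end Pattern

/-! ### Disjoint hypercyclicity of the pair -/

section Pair

variable {𝕜 : Type*} [RCLike 𝕜] {p : ℝ≥0∞} [Fact (1 ≤ p)]

theorem piMap_pow_apply {ι X : Type*} [NormedAddCommGroup X] [NormedSpace 𝕜 X]
    (T : ι → X →L[𝕜] X) (n : ℕ) (f : ι → X) (i : ι) :
    (ContinuousLinearMap.piMap T ^ n) f i = (T i ^ n) (f i) := by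
  induction n generalizing f with
  | zero => simp
  | succ n ih =>
    rw [pow_succ, pow_succ, mul_apply_eq_comp, mul_apply_eq_comp, ih]
    rfl

variable (p) in
theorem continuous_lpOfRange (m : ℕ) :
    Continuous fun f : ℕ → 𝕜 => (lpOfRange p m f : lp (fun _ : ℕ => 𝕜) p) :=
  continuous_finsetSum _ fun j _ =>
    (lp.isometry_single (E := fun _ : ℕ => 𝕜) (p := p) j).continuous.comp (continuous_apply j)

/-- Every open set of pairs contains a pair of finitely supported vectors whose quotient is
prescribed by values of `TopologicalSpace.denseSeq`. -/
theorem exists_lpOfRange_pair_mem (hp : p ≠ ∞) {U : Set (Fin 2 → lp (fun _ : ℕ => 𝕜) p)}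
    (hU : IsOpen U) (hne : U.Nonempty) {r : ℕ → 𝕜} (hr : ∀ j, r j ≠ 0) :
    ∃ (m : ℕ) (Y : Fin 2 → ℕ → 𝕜) (l : ℕ → ℕ), (fun i => lpOfRange p m (Y i)) ∈ U ∧
      ∀ j, TopologicalSpace.denseSeq 𝕜 (l j) ≠ 0 ∧
        Y 1 j * r j = Y 0 j * TopologicalSpace.denseSeq 𝕜 (l j) := by
  obtain ⟨y, hy⟩ := hne
  have hlim : Filter.Tendsto (fun m i => lpOfRange p m (y i)) Filter.atTop (nhds y) :=
    tendsto_pi_nhds.2 fun i => tendsto_lpOfRange hp (y i)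
  obtain ⟨m, hm⟩ := (hlim.eventually (hU.mem_nhds hy)).exists
  let G : (ℕ → 𝕜 × 𝕜) → Fin 2 → ℕ → 𝕜 := fun f => ![fun j => (f j).1, fun j => (f j).2]
  have hG : Continuous G := by
    refine continuous_pi fun i => ?_
    fin_cases i
    · exact continuous_pi fun j => (continuous_apply j).fst
    · exact continuous_pi fun j => (continuous_apply j).snd
  have hcont : Continuous fun f (i : Fin 2) => lpOfRange p m (G f i) :=
    continuous_pi fun i => (continuous_lpOfRange p m).comp ((continuous_apply i).comp hG)
  obtain ⟨f, hfU, hf⟩ := (dense_pi Set.univ fun j _ =>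
    dense_setOf_exists_denseSeq (hr j)).inter_open_nonempty _ (hU.preimage hcont)
    ⟨fun j => (y 0 j, y 1 j), by
      have : (fun i => lpOfRange p m (G (fun j => (y 0 j, y 1 j)) i)) =
          fun i => lpOfRange p m (y i) := by
        funext i
        fin_cases i <;> rfl
      rwa [Set.mem_preimage, this]⟩
  choose l hl using fun j => hf j (Set.mem_univ j)
  exact ⟨m, G f, l, hfU, hl⟩

/-- Since the second product is the first times `patternRatio`, the equality of block entries
reduces to this single relation. -/
theorem patternProducts_compat {Y : Fin 2 → ℕ → 𝕜} {n j : ℕ}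
    (h : Y 1 j * patternRatio 𝕜 j = Y 0 j * patternRatio 𝕜 (n + j)) (i i' : Fin 2) :
    Y i j * patternProducts 𝕜 i j / patternProducts 𝕜 i (n + j) =
      Y i' j * patternProducts 𝕜 i' j / patternProducts 𝕜 i' (n + j) := by
  have key : Y 0 j * patternProducts 𝕜 0 j / patternProducts 𝕜 0 (n + j) =
      Y 1 j * patternProducts 𝕜 1 j / patternProducts 𝕜 1 (n + j) := by
    have h1 := patternProducts_ne_zero 𝕜 0 (n + j)
    have h2 := patternRatio_ne_zero 𝕜 (n + j)
    rw [patternProducts_one, patternProducts_one, div_eq_div_iff h1 (mul_ne_zero h1 h2)]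
    linear_combination (-patternProducts 𝕜 0 j * patternProducts 𝕜 0 (n + j)) * h
  fin_cases i <;> fin_cases i' <;> first | rfl | exact key | exact key.symm

theorem areDisjointReiterativelyHypercyclic_patternProducts (hp : p ≠ ∞) :
    AreDisjointReiterativelyHypercyclic fun i : Fin 2 =>
      weightedShift p (ratioWeight (patternProducts 𝕜 i)) (isWeight_patternProducts 𝕜 i) := by
  have := separableSpace_lp (𝕜 := 𝕜) hp
  have : SecondCountableTopology (lp (fun _ : ℕ => 𝕜) p) :=
    UniformSpace.secondCountable_of_separable _
  set T := fun i : Fin 2 =>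
    weightedShift p (ratioWeight (patternProducts 𝕜 i)) (isWeight_patternProducts 𝕜 i) with hT
  have hcont : ∀ n, Continuous fun x : lp (fun _ : ℕ => 𝕜) p =>
      (ContinuousLinearMap.piMap T ^ n) fun _ => x := fun n =>
    (ContinuousLinearMap.piMap T ^ n).continuous.comp (continuous_pi fun _ => continuous_id)
  suffices h : ∀ U : Set (Fin 2 → lp (fun _ : ℕ => 𝕜) p), IsOpen U → U.Nonempty →
      ∃ δ, ∀ N, Dense {x | ∃ F ∈ denseInWindow (Set.Ioi 0) δ N, ∀ n ∈ F,
        ((ContinuousLinearMap.piMap T ^ n) fun _ => x) ∈ U} by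
    obtain ⟨x, hx⟩ := exists_forall_isOpen_exists_finset_subset hcont _ h
    refine ⟨x, fun U hU hne => ?_⟩
    obtain ⟨δ, hδ⟩ := hx U hU hne
    exact mem_posUpperBanachDensity δ hδ
  intro U hU hne
  obtain ⟨m, Y, l, hYU, hl⟩ := exists_lpOfRange_pair_mem hp hU hne (patternRatio_ne_zero 𝕜)
  obtain ⟨ε, hε, hεU⟩ := Metric.isOpen_iff.1 hU _ hYU
  obtain ⟨c, hc, hcV⟩ := exists_le_norm_patternProducts 𝕜
  obtain ⟨M, hmM, hM0, hM⟩ := exists_forall_norm_pow_sub_lt hp (isWeight_patternProducts 𝕜) hc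
    (by norm_num) (by norm_num) hcV Y m hε
  have hMR : (0 : ℝ) < M := by exact_mod_cast hM0
  refine ⟨⟨1 / (4 * M), by rw [Set.mem_Ioi]; positivity⟩,
    fun N => Metric.dense_iff.2 fun x₀ η hη => ?_⟩
  obtain ⟨d₀, hd₀⟩ := hM x₀ η hη
  have htwo : Filter.Tendsto (fun k : ℕ => (2 : ℝ) ^ k) Filter.atTop Filter.atTop :=
    tendsto_pow_atTop_atTop_of_one_lt one_lt_two
  have hgate : ∀ᶠ k in Filter.atTop, ∀ j ∈ Finset.range m,
      ‖TopologicalSpace.denseSeq 𝕜 (l j)‖ ≤ 2 ^ k ∧ ‖TopologicalSpace.denseSeq 𝕜 (l j)‖⁻¹ ≤ 2 ^ k :=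
    (Filter.eventually_all_finset _).2 fun j _ =>
      (htwo.eventually_ge_atTop _).and (htwo.eventually_ge_atTop _)
  -- The `k`-th interval carries the values needed by the target, with period `M`, and is long
  -- enough for `q ≥ 4`.
  obtain ⟨k, hcode, hk, hkN⟩ := ((frequently_patternCode_eq ((List.range m).map l, M)).and_eventually
    (hgate.and (Filter.eventually_ge_atTop (N + d₀ * M + 4 * M)))).exists
  have h2k : k < 2 ^ k := k.lt_two_pow_self
  -- The multiples `a * M, …, (a + q - 2) * M` start blocks of length `M` lying inside `[2 ^ k, 2 ^
  -- k + k)`. As `q ≥ 4`, their number `q - 1` is at least `k / (4 * M)`.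
  set a := 2 ^ k / M + 1 with ha
  set q := k / M with hq
  have ha1 : 2 ^ k ≤ a * M := by rw [ha, mul_comm]; exact (Nat.lt_mul_div_succ _ hM0).le
  have ha2 : a * M ≤ 2 ^ k + M := by
    rw [ha, add_mul, one_mul]; exact Nat.add_le_add_right (Nat.div_mul_le_self _ _) _
  have hq1 : k < (q + 1) * M := by rw [hq, mul_comm]; exact Nat.lt_mul_div_succ _ hM0
  have hq2 : q * M ≤ k := Nat.div_mul_le_self _ _
  have hq4 : 4 ≤ q := (Nat.le_div_iff_mul_le hM0).2 (by omega)
  have hda : d₀ ≤ a := by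
    by_contra h
    have := Nat.mul_le_mul_right M (not_le.1 h).le
    omega
  have hD : ∀ d ∈ Finset.Ico a (a + (q - 1)), 2 ^ k ≤ d * M ∧ d * M + M ≤ 2 ^ k + k := by
    intro d hd
    rw [Finset.mem_Ico] at hd
    refine ⟨ha1.trans (Nat.mul_le_mul_right _ hd.1), ?_⟩
    calc d * M + M = (d + 1) * M := by ring
      _ ≤ (a + (q - 1)) * M := Nat.mul_le_mul_right _ hd.2
      _ = a * M + (q - 1) * M := by ring
      _ ≤ 2 ^ k + (M + (q - 1) * M) := by omega
      _ = 2 ^ k + (q - 1 + 1) * M := by ring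
      _ ≤ 2 ^ k + k := by rw [Nat.sub_add_cancel (by omega)]; omega
  obtain ⟨x, hx, hxD⟩ := hd₀ (Finset.Ico a (a + (q - 1)))
    (fun d hd => hda.trans (Finset.mem_Ico.1 hd).1) (by
      intro d hd j hj
      refine patternProducts_compat ?_
      obtain ⟨hd1, hd2⟩ := hD d hd
      obtain ⟨r, hr⟩ := Nat.exists_eq_add_of_le (show 2 ^ k ≤ d * M + j by omega)
      -- Here `j < m ≤ M`, so `d * M + j` reduces to `j` modulo the period.
      have hlist : ((List.range m).map l).getD ((2 ^ k + r) % M) 0 = l j := by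
        rw [← hr, Nat.mul_add_mod', Nat.mod_eq_of_lt (by omega)]
        simp [hj]
      rw [hr, patternRatio_two_pow_add 𝕜 (by omega) hcode (hl j).1 (hk j (Finset.mem_range.2 hj)).1
        (hk j (Finset.mem_range.2 hj)).2 (by rw [hlist])]
      exact (hl j).2)
  refine ⟨x, by rwa [Metric.mem_ball, dist_eq_norm],
    (Finset.Ico a (a + (q - 1))).image (· * M),
    ⟨k, by omega, by omega, 2 ^ k - 1, ?_, ?_, ?_⟩, ?_⟩
  · rw [Set.mem_Ioi]
    omega
  · intro n hn
    simp only [Finset.coe_image, Set.mem_image, Finset.mem_coe] at hn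
    obtain ⟨d, hd, rfl⟩ := hn
    have := hD d hd
    rw [Set.mem_Icc]
    omega
  · rw [Finset.card_image_of_injective _ (mul_left_injective₀ hM0.ne'), Nat.card_Ico,
      Nat.add_sub_cancel_left]
    rw [one_div_mul_eq_div, div_le_iff₀ (by positivity)]
    have : k ≤ (q - 1) * (4 * M) := by
      obtain ⟨s, hs⟩ := Nat.exists_eq_add_of_le hq4
      rw [hs] at hq1 ⊢
      rw [show 4 + s - 1 = s + 3 by omega]
      nlinarith
    exact_mod_cast this
  · intro n hn
    obtain ⟨d, hd, rfl⟩ := Finset.mem_image.1 hn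
    refine hεU ?_
    rw [Metric.mem_ball, dist_pi_lt_iff hε]
    intro i
    rw [piMap_pow_apply, dist_eq_norm]
    exact hxD i d hd

theorem not_areDisjointUpperFrequentlyHypercyclic_patternProducts :
    ¬ AreDisjointUpperFrequentlyHypercyclic fun i : Fin 2 =>
      weightedShift p (ratioWeight (patternProducts 𝕜 i)) (isWeight_patternProducts 𝕜 i) := by
  rintro ⟨x, hx⟩
  -- Two balls of radius `1 / 2` around points at distance `2` are disjoint, so the two coordinates
  -- `0` cannot agree.
  let c : Fin 2 → 𝕜 := ![1, 3]
  have hcont : ∀ i : Fin 2, Continuous fun f : Fin 2 → lp (fun _ : ℕ => 𝕜) p => f i 0 := fun i =>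
    (continuous_apply 0).comp
      ((lp.uniformContinuous_coe (E := fun _ : ℕ => 𝕜) (p := p)).continuous.comp
        (continuous_apply (A := fun _ : Fin 2 => lp (fun _ : ℕ => 𝕜) p) i))
  have hU := hx {f | ∀ i, ‖f i 0 - c i‖ < 1 / 2} ?_ ⟨fun i => lp.single p 0 (c i), fun i => by
    rw [lp.single_apply_self]; norm_num⟩
  · refine absurd (show (0 : ℝ) < upperDensity _ from hU)
      (not_lt.2 (upperDensity_nonpos_of_subset_isSparseTime fun n hn => ?_))
    by_contra hs
    have h0 : ¬ IsSparseTime 0 := by simp [IsSparseTime]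
    have hn' : ∀ i, ‖patternProducts 𝕜 i n / patternProducts 𝕜 i 0 * x n - c i‖ < 1 / 2 := by
      intro i
      have := hn i
      rwa [piMap_pow_apply, weightedShift_ratioWeight_pow_apply (patternProducts_ne_zero 𝕜 i),
        zero_add] at this
    have h1 := hn' 0
    have h2 := hn' 1
    rw [patternProducts_one, patternProducts_one, patternRatio_of_not_isSparseTime 𝕜 hs,
      patternRatio_of_not_isSparseTime 𝕜 h0, mul_one, mul_one] at h2
    have h3 : ‖(2 : 𝕜)‖ < 2 := by
      have := norm_sub_le (patternProducts 𝕜 0 n / patternProducts 𝕜 0 0 * x n - c 0)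
        (patternProducts 𝕜 0 n / patternProducts 𝕜 0 0 * x n - c 1)
      rw [sub_sub_sub_cancel_left, show c 1 - c 0 = 2 by simp [c]; norm_num] at this
      linarith
    simp at h3
  · have : {f : Fin 2 → lp (fun _ : ℕ => 𝕜) p | ∀ i, ‖f i 0 - c i‖ < 1 / 2} =
        ⋂ i, {f | ‖f i 0 - c i‖ < 1 / 2} := by
      ext f
      simp
    rw [this]
    exact isOpen_iInter_of_finite fun i =>
      isOpen_lt ((hcont i).sub continuous_const).norm continuous_const

end Pair

theorem mainTheorem10 {𝕜 : Type*} [RCLike 𝕜] (p : ℝ≥0∞) [Fact (1 ≤ p)] (hp : p ≠ ∞) :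
    ∃ (v w : ℕ → 𝕜) (hv : IsWeight v) (hw : IsWeight w),
      IsUpperFrequentlyHypercyclic (weightedShift p v hv) ∧
      IsUpperFrequentlyHypercyclic (weightedShift p w hw) ∧
      AreDisjointReiterativelyHypercyclic ![weightedShift p v hv, weightedShift p w hw] ∧
      ¬ AreDisjointUpperFrequentlyHypercyclic ![weightedShift p v hv, weightedShift p w hw] := by
  obtain ⟨c, hc, hcV⟩ := exists_le_norm_patternProducts 𝕜
  have hT : ![weightedShift p (ratioWeight (patternProducts 𝕜 0)) (isWeight_patternProducts 𝕜 0),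
      weightedShift p (ratioWeight (patternProducts 𝕜 1)) (isWeight_patternProducts 𝕜 1)] =
      fun i : Fin 2 =>
        weightedShift p (ratioWeight (patternProducts 𝕜 i)) (isWeight_patternProducts 𝕜 i) := by
    funext i
    fin_cases i <;> rfl
  refine ⟨_, _, isWeight_patternProducts 𝕜 0, isWeight_patternProducts 𝕜 1,
    isUpperFrequentlyHypercyclic_ratioWeight hp _ hc (by norm_num) (by norm_num) (hcV 0),
    isUpperFrequentlyHypercyclic_ratioWeight hp _ hc (by norm_num) (by norm_num) (hcV 1), ?_, ?_⟩
  · rw [hT]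
    exact areDisjointReiterativelyHypercyclic_patternProducts hp
  · rw [hT]
    exact not_areDisjointUpperFrequentlyHypercyclic_patternProducts
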